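/- Let $\tau=(x_1,\dots,x_n)$ be a finite (possibly empty) sequence of real numbers, and put $x_0=x_{n+1}=\infty$. The directed horizon visibility graph of $\tau$ is the directed graph with vertices $0,1,\dots,n+1$ in which there is an edge from $i$ to $j$ exactly when $i<j$ and $x_k<x_i$ and $x_k<x_j$ for every $k$ with $i<k<j$. Its in-degree sequence is $(d^{\mathrm{in}}_0,\dots,d^{\mathrm{in}}_{n+1})$ and its out-degree sequence is $(d^{\mathrm{out}}_0,\dots,d^{\mathrm{out}}_{n+1})$, where $d^{\mathrm{in}}_i$ and $d^{\mathrm{out}}_i$ are the numbers of edges ending, respectively starting, at vertex $i$. Theorem. The in-degree and out-degree sequences of a directed horizon visibility graph uniquely determine it: if $\tau=(x_1,\dots,x_n)$ and $\sigma=(y_1,\dots,y_m)$ are finite sequences of real numbers whose directed horizon visibility graphs have the same in-degree sequence and the same out-degree sequence, then $n=m$ and the two graphs have exactly the same edges. -/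

import Mathlib

/-- The directed horizontal visibility graph of a finite series `x = (x 0, …, x (N - 1))` with
values in a linear order: there is an edge from `i` to `j` exactly when `i < j` and every value
strictly between positions `i` and `j` is strictly below both `x i` and `x j`. -/
def directedHVG {α : Type*} [LinearOrder α] {N : ℕ} (x : Fin N → α) : Digraph (Fin N) where
  Adj i j := i < j ∧ ∀ k, i < k → k < j → x k < x i ∧ x k < x j

/-- The series `(∞, x₁, …, xₙ, ∞)` obtained from a real time series `(x₁, …, xₙ)`. -/
def extendByInfinity {n : ℕ} (τ : Fin n → ℝ) : Fin (n + 2) → WithTop ℝ :=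
  Fin.cons ⊤ (Fin.snoc (fun i => (τ i : WithTop ℝ)) ⊤)

/-- The directed horizon visibility graph of a real time series: the directed horizontal
visibility graph of the series extended by `∞` at both ends. -/
noncomputable def directedHorizonVG {n : ℕ} (τ : Fin n → ℝ) : Digraph (Fin (n + 2)) :=
  directedHVG (extendByInfinity τ)

/-- The sequence of in-degrees, in the order of the vertices. -/
noncomputable def inDegreeSeq {N : ℕ} (G : Digraph (Fin N)) : List ℕ :=
  List.ofFn fun v => {u | G.Adj u v}.ncard

/-- The sequence of out-degrees, in the order of the vertices. -/
noncomputable def outDegreeSeq {N : ℕ} (G : Digraph (Fin N)) : List ℕ :=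
  List.ofFn fun v => {w | G.Adj v w}.ncard

/-! Only forwardness and noncrossing matter. Induct on the target `j`, edges into earlier vertices
being known. Suppose `a → j` in `G`, `b → j` in `H`, `a < b`. In `G`, no edge leaves `b` past `j`,
so without `b → j` all out-edges of `b` would lie in `H`, which has one more: out-degrees would
differ. Equal in-degrees finish. -/

theorem directedHVG_adj_lt {α : Type*} [LinearOrder α] {N : ℕ} (x : Fin N → α) {i j : Fin N}
    (h : (directedHVG x).Adj i j) : i < j := h.1

/-- Edges of a directed horizontal visibility graph do not cross. -/
theorem directedHVG_noncrossing {α : Type*} [LinearOrder α] {N : ℕ} (x : Fin N → α)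
    {i k j l : Fin N} (hik : i < k) (hkj : k < j) (hjl : j < l)
    (hij : (directedHVG x).Adj i j) : ¬ (directedHVG x).Adj k l := fun hkl =>
  lt_asymm (hij.2 k hik hkj).2 (hkl.2 j hkj hjl).1

/-- If two forward-directed graphs agree on all edges ending before `j`, the first is noncrossing,
and out-degrees agree, then an in-neighbour of `j` in the second graph that lies to the right of
an in-neighbour of `j` in the first graph is itself an in-neighbour of `j` in the first graph. -/
theorem adj_of_lt_of_outDegree_eq {N : ℕ} {G H : Digraph (Fin N)}
    (hHlt : ∀ i j, H.Adj i j → i < j)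
    (hG : ∀ i k j l, i < k → k < j → j < l → G.Adj i j → ¬ G.Adj k l)
    (hout : ∀ v, {w | G.Adj v w}.ncard = {w | H.Adj v w}.ncard)
    {j : Fin N} (ih : ∀ k < j, ∀ i, G.Adj i k ↔ H.Adj i k)
    {a b : Fin N} (ha : G.Adj a j) (hb : H.Adj b j) (hab : a < b) : G.Adj b j := by
  by_contra hbj
  have hss : {w | G.Adj b w} ⊂ {w | H.Adj b w} := by
    refine (Set.ssubset_iff_of_subset fun w hw => ?_).2 ⟨j, hb, hbj⟩
    rcases lt_trichotomy w j with h | rfl | h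
    · exact (ih w h b).1 hw
    · exact absurd hw hbj
    · exact absurd hw (hG a b j w hab (hHlt b j hb) h ha)
  exact (Set.ncard_lt_ncard hss (Set.toFinite _)).ne (hout b)

/-- A forward-directed noncrossing graph on `Fin N` is determined by its in- and out-degrees. -/
theorem adj_iff_of_noncrossing_of_degree_eq {N : ℕ} {G H : Digraph (Fin N)}
    (hGlt : ∀ i j, G.Adj i j → i < j) (hHlt : ∀ i j, H.Adj i j → i < j)
    (hG : ∀ i k j l, i < k → k < j → j < l → G.Adj i j → ¬ G.Adj k l)
    (hH : ∀ i k j l, i < k → k < j → j < l → H.Adj i j → ¬ H.Adj k l)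
    (hin : ∀ v, {u | G.Adj u v}.ncard = {u | H.Adj u v}.ncard)
    (hout : ∀ v, {w | G.Adj v w}.ncard = {w | H.Adj v w}.ncard) (j : Fin N) :
    ∀ i, G.Adj i j ↔ H.Adj i j := by
  induction j using WellFoundedLT.induction with
  | ind j ih =>
    suffices h : {u | G.Adj u j} = {u | H.Adj u j} from fun i => Set.ext_iff.1 h i
    by_cases hsub : {u | G.Adj u j} ⊆ {u | H.Adj u j}
    · exact Set.eq_of_subset_of_ncard_le hsub (hin j).ge (Set.toFinite _)
    · obtain ⟨a, ha, haH⟩ := Set.not_subset.1 hsub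
      -- One `a` missing from `H` forces the reverse inclusion: an in-neighbour `b < a` in `H`
      -- would, with the roles swapped, put `a` in `H`.
      refine (Set.eq_of_subset_of_ncard_le (fun b hb => ?_) (hin j).le (Set.toFinite _)).symm
      rcases lt_trichotomy a b with h | rfl | h
      · exact adj_of_lt_of_outDegree_eq hHlt hG hout ih ha hb h
      · exact ha
      · exact absurd (adj_of_lt_of_outDegree_eq hGlt hH (fun v => (hout v).symm)
          (fun k hk i => (ih k hk i).symm) hb ha h) haH

theorem mainTheorem3 {n m : ℕ} (τ : Fin n → ℝ) (σ : Fin m → ℝ)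
    (hin : inDegreeSeq (directedHorizonVG τ) = inDegreeSeq (directedHorizonVG σ))
    (hout : outDegreeSeq (directedHorizonVG τ) = outDegreeSeq (directedHorizonVG σ)) :
    ∃ h : n = m, ∀ i j : Fin (n + 2),
      (directedHorizonVG τ).Adj i j ↔
        (directedHorizonVG σ).Adj (Fin.cast (congrArg (· + 2) h) i)
          (Fin.cast (congrArg (· + 2) h) j) := by
  have hnm : n = m := by
    have := congrArg List.length hin
    simpa [inDegreeSeq] using this
  subst hnm
  refine ⟨rfl, fun i j => ?_⟩
  exact adj_iff_of_noncrossing_of_degree_eq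
    (fun _ _ => directedHVG_adj_lt _) (fun _ _ => directedHVG_adj_lt _)
    (fun _ _ _ _ => directedHVG_noncrossing _) (fun _ _ _ _ => directedHVG_noncrossing _)
    (congrFun (List.ofFn_injective hin)) (congrFun (List.ofFn_injective hout)) j i
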